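/- Let $p=p_1\cdots p_k$ be a pattern, i.e. a finite word over an alphabet of variables, in which exactly $r$ distinct variables occur, the $j$th one $k_j\ge 1$ times, numbered so that $1=k_1=\cdots=k_s<k_{s+1}\le\cdots\le k_r$ (so $s$ is the number of variables that occur exactly once, and $k=k_1+\cdots+k_r$). For a word $w$ over an alphabet $\mathcal A$, the number of occurrences of $p$ in $w$ in the abelian sense is the sum, over all sequences $(u_1,\ldots,u_k)$ of nonempty words over $\mathcal A$ such that $u_i$ is a rearrangement of the letters of $u_j$ whenever $p_i=p_j$, of the number of positions at which the concatenation $u_1\cdots u_k$ occurs as a factor of $w$. Let $m\ge 4$, let $|\mathcal A|=m$, and let $\widehat\Omega_n$ be the mean of this number over all $m^n$ words $w$ of length $n$ over $\mathcal A$, each being equally likely. Then, for every $j$ with $s<j\le r$, the series $$\sum_{\ell=1}^{\infty}\frac{1}{m^{k_j\ell}}\sum_{i_1+\cdots+i_m=\ell}\binom{\ell}{i_1,\ldots,i_m}^{k_j}$$ (the inner sum being over nonnegative integers $i_1,\ldots,i_m$) converges, and, as $n\to\infty$, $$\widehat{\Omega}_n\sim\frac{n^{s+1}}{(s+1)!}\prod_{j=s+1}^r\left[\sum_{\ell=1}^{\infty}\frac{1}{m^{k_j\ell}}\sum_{i_1+\cdots+i_m=\ell}\binom{\ell}{i_1,\ldots,i_m}^{k_j}\right].$$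 -/

import Mathlib

/-- The number of times the word `v` occurs as a factor of the word `w`, i.e. the number of
positions `0 ≤ i ≤ |w|` such that `v` is a prefix of what remains of `w` after its first
`i` letters. -/
def factorCount {A : Type*} [DecidableEq A] (v w : List A) : ℕ :=
  ((Finset.range (w.length + 1)).filter (fun i => v <+: w.drop i)).card

/-- The sequence of words `u₁, …, u_k` is an abelian substitution instance of the pattern
`p = p₁ ⋯ p_k`: all `u_i` are nonempty, and `u_i` is a rearrangement of `u_j` whenever
`p_i = p_j`. -/
def IsAbelianInstance {V A : Type*} (p : List V) (u : Fin p.length → List A) : Prop :=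
  (∀ i, u i ≠ []) ∧ ∀ i j, p.get i = p.get j → (u i).Perm (u j)

/-- The number of occurrences of the pattern `p` in the word `w` in the abelian sense: the sum,
over all abelian instances `(u₁, …, u_k)` of `p`, of the number of times that the concatenation
`u₁ ⋯ u_k` occurs as a factor of `w`. Only finitely many terms are nonzero
(`finite_abelianInstances`). -/
noncomputable def abelianCount {V A : Type*} [DecidableEq A] (p : List V) (w : List A) : ℕ :=
  ∑ᶠ (u : Fin p.length → List A) (_ : IsAbelianInstance p u),
    factorCount (List.ofFn u).flatten w

theorem finite_abelianInstances {V A : Type*} [DecidableEq A] (p : List V) (w : List A) :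
    {u : Fin p.length → List A | factorCount (List.ofFn u).flatten w ≠ 0}.Finite := by
  refine (Set.Finite.pi' (t := fun _ => {x : List A | x ∈ w.sublists})
    (fun _ => List.finite_toSet _)).subset ?_
  intro u hu j
  obtain ⟨i, hi⟩ := Finset.card_ne_zero.mp hu
  have h := (Finset.mem_filter.mp hi).2
  rw [Set.mem_setOf_eq, List.mem_sublists]
  refine (List.sublist_flatten_of_mem ?_).trans (h.sublist.trans (List.drop_sublist i w))
  exact (List.mem_ofFn' _ _).mpr ⟨j, rfl⟩

/-- The mean, over all words of length `n` over the finite alphabet `A` (each being equally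
likely), of the number of occurrences of `p` in the abelian sense. -/
noncomputable def meanAbelianCount {V : Type*} (A : Type*) [Fintype A] [DecidableEq A]
    (p : List V) (n : ℕ) : ℝ :=
  (∑ w : Fin n → A, (abelianCount p (List.ofFn w) : ℝ)) / (Fintype.card A : ℝ) ^ n

/-- `m ^ (-kℓ) * ∑_{i₁ + ⋯ + i_m = ℓ} multinomial(ℓ; i₁, …, i_m) ^ k`. -/
noncomputable def abelianTerm (m k l : ℕ) : ℝ :=
  1 / (m : ℝ) ^ (k * l) *
    ∑ i ∈ Finset.piAntidiag (Finset.univ : Finset (Fin m)) l,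
      (Nat.multinomial Finset.univ i : ℝ) ^ k

open scoped ENNReal
open Filter Topology

/-! A fixed word of length `L ≤ n` occurs on average `(n + 1 - L) / m ^ L` times. Substitutions are
grouped first by the letter counts chosen for each variable (a multinomial number of words for each
occurrence), then by length. The mean becomes a sum over lengths `l_v ≥ 1` of `∏ abelianTerm m k_v
l_v` times the truncated difference `n + 1 - ∑ k_v l_v` (`ofReal_meanAbelianCount_eq_tsum_length`).
Working in `ℝ≥0∞` makes these regroupings free of summability conditions.

If `k_v = 1` the factor is 1, so the `s` lengths of such variables sum out by the hockey-stick
identity, leaving a binomial coefficient with lower index `s + 1`. Divided by `n ^ (s + 1)` it tends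
to `1 / (s + 1)!` and stays bounded, so dominated convergence gives the limit
(`tendsto_div_pow_of_ofReal_eq_tsum`).

The dominating series converges because, for `k ≥ 2`, `abelianTerm m k l` is at most the largest
multinomial probability, which Stirling bounds by a constant times `l ^ (-3/2)` when `m ≥ 4`
(`abelianTerm_le`). -/

theorem ENNReal.tsum_fin_pi_prod {α : Type*} : ∀ {n : ℕ} (f : Fin n → α → ℝ≥0∞),
    ∑' x : Fin n → α, ∏ i, f i (x i) = ∏ i, ∑' a, f i a
  | 0, f => by simp
  | n + 1, f => by
    rw [← (Fin.consEquiv fun _ => α).tsum_eq, ENNReal.tsum_prod', Fin.prod_univ_succ,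
      ← ENNReal.tsum_fin_pi_prod, ← ENNReal.tsum_mul_right]
    refine tsum_congr fun a => ?_
    rw [← ENNReal.tsum_mul_left]
    refine tsum_congr fun x => ?_
    rw [Fin.prod_univ_succ]
    simp [Fin.consEquiv]

/-- A sum of products over a finite power is the product of the sums. -/
theorem ENNReal.tsum_pi_prod {ι α : Type*} [Fintype ι] (f : ι → α → ℝ≥0∞) :
    ∑' x : ι → α, ∏ i, f i (x i) = ∏ i, ∑' a, f i a := by
  have e := Fintype.equivFin ι
  rw [← (e.symm.arrowCongr (Equiv.refl α)).tsum_eq, ← e.symm.prod_comp,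
    ← ENNReal.tsum_fin_pi_prod]
  refine tsum_congr fun x => ?_
  rw [← e.symm.prod_comp]
  simp

/-- Summation over a finite power, grouped by the values of a function of the coordinates. -/
theorem ENNReal.tsum_pi_prod_mul_comp {ι α β : Type*} [Fintype ι] [DecidableEq β]
    (f : ι → α → ℝ≥0∞) (c : α → β) (G : (ι → β) → ℝ≥0∞) :
    ∑' x : ι → α, (∏ i, f i (x i)) * G (fun i => c (x i)) =
      ∑' y : ι → β, (∏ i, ∑' a, if c a = y i then f i a else 0) * G y := by
  simp_rw [← ENNReal.tsum_pi_prod, ← ENNReal.tsum_mul_right]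
  rw [ENNReal.tsum_comm]
  refine tsum_congr fun x => ?_
  rw [tsum_eq_single (fun i => c (x i))]
  · simp
  · intro y hy
    obtain ⟨i, hi⟩ := Function.ne_iff.mp hy
    rw [Finset.prod_eq_zero (Finset.mem_univ i) (if_neg (Ne.symm hi)), zero_mul]

/-! ### Counting words by factors and by letter counts -/

theorem Fin.sum_univ_consEquiv {A M : Type*} [Fintype A] [AddCommMonoid M] (n : ℕ)
    (g : (Fin (n + 1) → A) → M) :
    ∑ w, g w = ∑ a, ∑ w : Fin n → A, g (Fin.cons a w) := by
  rw [← (Fin.consEquiv fun _ => A).sum_comp, Fintype.sum_prod_type]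
  rfl

theorem sum_ite_isPrefix {A : Type*} [Fintype A] [DecidableEq A] :
    ∀ (v : List A) (n : ℕ), (∑ w : Fin n → A, if v <+: List.ofFn w then 1 else 0) =
      if v.length ≤ n then Fintype.card A ^ (n - v.length) else 0
  | [], n => by simp
  | a :: v, 0 => by simp
  | a :: v, n + 1 => by
    rw [Fin.sum_univ_consEquiv, Finset.sum_eq_single a]
    · simp [List.ofFn_succ, List.cons_prefix_cons, sum_ite_isPrefix v n]
    · intro b _ hb
      simp [List.ofFn_succ, List.cons_prefix_cons, hb.symm]
    · simp

theorem sum_ite_isPrefix_drop {A : Type*} [Fintype A] [DecidableEq A] (v : List A) :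
    ∀ (i n : ℕ), i ≤ n →
      (∑ w : Fin n → A, if v <+: (List.ofFn w).drop i then 1 else 0) =
      if i + v.length ≤ n then Fintype.card A ^ (n - v.length) else 0
  | 0, n, _ => by simpa using sum_ite_isPrefix v n
  | i + 1, n + 1, h => by
    rw [Fin.sum_univ_consEquiv]
    simp only [List.ofFn_succ, List.drop_succ_cons, Fin.cons_succ]
    rw [sum_ite_isPrefix_drop v i n (by omega)]
    by_cases h' : i + v.length ≤ n
    · rw [if_pos h', if_pos (by omega), show n + 1 - v.length = n - v.length + 1 by omega, pow_succ']
      simp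
    · rw [if_neg h', if_neg (by omega)]
      simp

/-- Sum over positions first: each admissible position leaves `n - |v|` letters free. Truncated
subtraction gives 0 when `v` is too long. -/
theorem sum_factorCount {A : Type*} [Fintype A] [DecidableEq A] (v : List A) (n : ℕ) :
    ∑ w : Fin n → A, factorCount v (List.ofFn w) =
      (n + 1 - v.length) * Fintype.card A ^ (n - v.length) := by
  simp only [factorCount, Finset.card_filter, List.length_ofFn]
  rw [Finset.sum_comm, Finset.sum_congr rfl fun i hi =>
    sum_ite_isPrefix_drop v i n (by simpa [Nat.lt_succ_iff] using hi), ← Finset.sum_filter,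
    Finset.sum_const, smul_eq_mul]
  congr 1
  rw [← Finset.card_range (n + 1 - v.length)]
  congr 1
  ext i
  simp
  omega

theorem sum_count_eq_length {A : Type*} [Fintype A] [DecidableEq A] (l : List A) :
    ∑ a, l.count a = l.length := by
  simpa using Multiset.sum_count_eq_card (s := Finset.univ) (m := (l : Multiset A)) (by simp)

theorem coeff_prod_map_X {A : Type*} [Fintype A] [DecidableEq A] (l : List A) (x : A →₀ ℕ) :
    MvPolynomial.coeff x (l.map (MvPolynomial.X (R := ℕ))).prod =
      if (fun a => l.count a) = x then 1 else 0 := by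
  have h : (l.map (MvPolynomial.X (R := ℕ))).prod =
      MvPolynomial.monomial (Multiset.toFinsupp (l : Multiset A)) 1 := by
    induction l with
    | nil => simp
    | cons a l ih =>
      rw [List.map_cons, List.prod_cons, ih, MvPolynomial.X, MvPolynomial.monomial_mul,
        ← Multiset.cons_coe, ← Multiset.singleton_add, Multiset.toFinsupp_add,
        Multiset.toFinsupp_singleton, mul_one]
  rw [h, MvPolynomial.coeff_monomial]
  refine if_congr ?_ rfl rfl
  rw [← DFunLike.coe_injective.eq_iff]
  refine Eq.congr ?_ rfl
  ext a
  simp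

/-- Expanding `(∑ X_a) ^ n` gives one monomial per word, with the letter counts as exponents;
compare coefficients with the multinomial theorem. -/
theorem card_ofFn_count_eq {A : Type*} [Fintype A] [DecidableEq A] (x : A → ℕ) (n : ℕ) :
    (∑ w : Fin n → A, if (fun a => (List.ofFn w).count a) = x then 1 else 0) =
      if ∑ a, x a = n then Nat.multinomial Finset.univ x else 0 := by
  let y : A →₀ ℕ := Finsupp.equivFunOnFinite.symm x
  have hy : (y : A → ℕ) = x := by ext; simp [y]
  have h := MvPolynomial.coeff_sum_X_pow_of_fintype (R := ℕ) y n
  rw [Finset.sum_pow', MvPolynomial.coeff_sum] at h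
  simp only [Fintype.piFinset_univ] at h
  rw [Finsupp.multinomial_eq_of_support_subset (Finset.subset_univ _),
    Finsupp.sum_fintype _ _ (by simp), hy] at h
  simp only [Nat.cast_id] at h
  rw [← h]
  refine Finset.sum_congr rfl fun w _ => ?_
  have := coeff_prod_map_X (List.ofFn w) y
  rw [hy, List.map_ofFn, List.prod_ofFn] at this
  rw [← this]
  rfl

/-- The number of words with prescribed letter counts is a multinomial coefficient. -/
theorem tsum_ite_count_eq {A : Type*} [Fintype A] [DecidableEq A] (x : A → ℕ) :
    (∑' l : List A, if (fun a => l.count a) = x then (1 : ℝ≥0∞) else 0) =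
      Nat.multinomial Finset.univ x := by
  rw [← List.equivSigmaTuple.symm.tsum_eq, ENNReal.tsum_sigma',
    tsum_eq_single (∑ a, x a)]
  · have h := card_ofFn_count_eq x (∑ a, x a)
    rw [if_pos rfl] at h
    rw [← h, tsum_fintype]
    push_cast
    rfl
  · intro n hn
    have h := card_ofFn_count_eq x n
    rw [if_neg hn.symm] at h
    have h' := congrArg (Nat.cast (R := ℝ≥0∞)) h
    push_cast at h'
    rw [tsum_fintype]
    exact h'

theorem List.prod_get_eq_prod_pow_count {V M : Type*} [DecidableEq V] [CommMonoid M] (p : List V)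
    (F : p.toFinset → M) :
    ∏ i : Fin p.length, F ⟨p.get i, List.mem_toFinset.mpr (p.get_mem i)⟩ =
      ∏ v : p.toFinset, F v ^ p.count v.1 := by
  let F' : V → M := fun v => if h : v ∈ p.toFinset then F ⟨v, h⟩ else 1
  have h : ∀ v : p.toFinset, F v = F' v.1 := fun v => by simp only [F', dif_pos v.2]
  simp_rw [h]
  rw [Finset.prod_coe_sort p.toFinset (fun v => F' v ^ p.count v), ← Finset.prod_list_map_count,
    ← List.prod_ofFn]
  congr 1
  conv_rhs => rw [← List.ofFn_get p, List.map_ofFn]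
  rfl

theorem List.sum_get_eq_sum_count_mul {V : Type*} [DecidableEq V] (p : List V)
    (F : p.toFinset → ℕ) :
    ∑ i : Fin p.length, F ⟨p.get i, List.mem_toFinset.mpr (p.get_mem i)⟩ =
      ∑ v : p.toFinset, p.count v.1 * F v := by
  exact p.prod_get_eq_prod_pow_count fun v => Multiplicative.ofAdd (F v)

/-! ### The mean as a sum over counts and lengths -/

open Classical in
theorem abelianCount_eq_tsum {V A : Type*} [DecidableEq A] (p : List V) (w : List A) :
    (abelianCount p w : ℝ≥0∞) = ∑' u : Fin p.length → List A,
      if IsAbelianInstance p u then (factorCount (List.ofFn u).flatten w : ℝ≥0∞) else 0 := by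
  have h1 : abelianCount p w = ∑ᶠ u : Fin p.length → List A,
      if IsAbelianInstance p u then factorCount (List.ofFn u).flatten w else 0 :=
    finsum_congr fun u => finsum_eq_if
  have hfin : (Function.support fun u : Fin p.length → List A =>
      if IsAbelianInstance p u then factorCount (List.ofFn u).flatten w else 0).Finite := by
    refine (finite_abelianInstances p w).subset fun u hu => ?_
    by_cases hi : IsAbelianInstance p u
    · simpa [hi] using hu
    · simp [hi] at hu
  rw [h1, finsum_eq_sum _ hfin, tsum_eq_sum (s := hfin.toFinset)]
  · push_cast
    rfl
  · intro u hu
    rw [Set.Finite.mem_toFinset, Function.mem_support, not_not] at hu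
    exact_mod_cast congrArg (Nat.cast (R := ℝ≥0∞)) hu

open Classical in
theorem ofReal_meanAbelianCount {V A : Type*} [Fintype A] [DecidableEq A] [Nonempty A]
    (p : List V) (n : ℕ) :
    ENNReal.ofReal (meanAbelianCount A p n) = ∑' u : Fin p.length → List A,
      if IsAbelianInstance p u then ((n + 1 - ∑ i, (u i).length : ℕ) : ℝ≥0∞) /
        (Fintype.card A : ℝ≥0∞) ^ (∑ i, (u i).length) else 0 := by
  have hpos : (0 : ℝ) < Fintype.card A := by exact_mod_cast Fintype.card_pos
  have hm0 : (Fintype.card A : ℝ≥0∞) ≠ 0 := by exact_mod_cast Fintype.card_ne_zero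
  have hmt : (Fintype.card A : ℝ≥0∞) ≠ ⊤ := ENNReal.natCast_ne_top _
  rw [meanAbelianCount, ENNReal.ofReal_div_of_pos (by positivity),
    ENNReal.ofReal_sum_of_nonneg (fun _ _ => by positivity), ENNReal.ofReal_pow hpos.le]
  simp only [ENNReal.ofReal_natCast, abelianCount_eq_tsum]
  rw [← Summable.tsum_finsetSum (fun _ _ => ENNReal.summable), div_eq_mul_inv,
    ← ENNReal.tsum_mul_right]
  refine tsum_congr fun u => ?_
  by_cases hi : IsAbelianInstance p u
  · simp only [hi, if_true]
    rw [← Nat.cast_sum, sum_factorCount, List.length_flatten, List.map_ofFn, List.sum_ofFn]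
    simp only [Function.comp_apply]
    set L := ∑ i, (u i).length
    by_cases hL : L ≤ n
    · obtain ⟨j, rfl⟩ := Nat.exists_eq_add_of_le hL
      rw [Nat.add_sub_cancel_left, pow_add, Nat.cast_mul, Nat.cast_pow, div_eq_mul_inv, mul_assoc,
        ENNReal.mul_inv (by simp [hm0]) (by simp [hmt]), mul_left_comm _ (_ ^ L)⁻¹,
        ENNReal.mul_inv_cancel (pow_ne_zero _ hm0) (ENNReal.pow_ne_top hmt), mul_one]
    · rw [Nat.sub_eq_zero_of_le (by omega)]
      simp
  · simp [hi]

theorem abelianTerm_eq_sum_piAntidiag {A : Type*} [Fintype A] [DecidableEq A] (k l : ℕ) :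
    abelianTerm (Fintype.card A) k l = ∑ x ∈ Finset.piAntidiag (Finset.univ : Finset A) l,
      ((Nat.multinomial Finset.univ x : ℝ) / (Fintype.card A : ℝ) ^ l) ^ k := by
  have e := Fintype.equivFin A
  rw [abelianTerm, Finset.mul_sum]
  refine Finset.sum_bij' (fun i _ => i ∘ e) (fun x _ => x ∘ e.symm) ?_ ?_ ?_ ?_ ?_
  · intro i hi
    rw [Finset.mem_piAntidiag] at hi ⊢
    exact ⟨by rw [← hi.1]; exact e.sum_comp i, by simp⟩
  · intro i hi
    rw [Finset.mem_piAntidiag] at hi ⊢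
    exact ⟨by rw [← hi.1]; exact e.symm.sum_comp i, by simp⟩
  · intro i _; ext; simp
  · intro i _; ext; simp
  · intro i _
    have h : Nat.multinomial Finset.univ (i ∘ e) = Nat.multinomial Finset.univ i := by
      simp only [Nat.multinomial, Function.comp_apply]
      rw [e.sum_comp i, e.prod_comp (fun a => (i a).factorial)]
    rw [h, div_pow, ← pow_mul, mul_comm l k]
    ring

theorem abelianTerm_nonneg (m k l : ℕ) : 0 ≤ abelianTerm m k l := by
  unfold abelianTerm
  positivity

theorem tsum_multinomial_eq_abelianTerm {A : Type*} [Fintype A] [DecidableEq A] [Nonempty A]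
    (k l : ℕ) :
    (∑' x : A → ℕ, if ∑ a, x a = l then
      ((Nat.multinomial Finset.univ x : ℝ≥0∞) / (Fintype.card A : ℝ≥0∞) ^ (∑ a, x a)) ^ k
      else 0) = ENNReal.ofReal (abelianTerm (Fintype.card A) k l) := by
  have hpos : (0 : ℝ) < Fintype.card A := by exact_mod_cast Fintype.card_pos
  rw [tsum_eq_sum (s := Finset.piAntidiag Finset.univ l), abelianTerm_eq_sum_piAntidiag,
    ENNReal.ofReal_sum_of_nonneg (fun _ _ => by positivity)]
  · refine Finset.sum_congr rfl fun x hx => ?_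
    rw [Finset.mem_piAntidiag] at hx
    rw [if_pos hx.1, hx.1, ENNReal.ofReal_pow (by positivity),
      ENNReal.ofReal_div_of_pos (by positivity), ENNReal.ofReal_pow hpos.le,
      ENNReal.ofReal_natCast, ENNReal.ofReal_natCast]
  · intro x hx
    rw [if_neg]
    intro h
    exact hx (Finset.mem_piAntidiag.mpr ⟨h, by simp⟩)

open Classical in
/-- The mean as a sum over the letter counts of the words substituted for the variables. -/
theorem ofReal_meanAbelianCount_eq_tsum_count {V A : Type*} [DecidableEq V] [Fintype A]
    [DecidableEq A] [Nonempty A] (p : List V) (n : ℕ) :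
    ENNReal.ofReal (meanAbelianCount A p n) = ∑' x : p.toFinset → A → ℕ,
      (∏ v, (Nat.multinomial Finset.univ (x v) : ℝ≥0∞) ^ p.count v.1) *
        if ∀ v, x v ≠ 0 then ((n + 1 - ∑ v, p.count v.1 * ∑ a, x v a : ℕ) : ℝ≥0∞) /
          (Fintype.card A : ℝ≥0∞) ^ (∑ v, p.count v.1 * ∑ a, x v a) else 0 := by
  let G : (Fin p.length → A → ℕ) → ℝ≥0∞ := fun y =>
    if (∀ i, y i ≠ 0) ∧ ∀ i j, p.get i = p.get j → y i = y j then
      ((n + 1 - ∑ i, ∑ a, y i a : ℕ) : ℝ≥0∞) / (Fintype.card A : ℝ≥0∞) ^ (∑ i, ∑ a, y i a)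
    else 0
  have h1 : ENNReal.ofReal (meanAbelianCount A p n) = ∑' u : Fin p.length → List A,
      (∏ _i : Fin p.length, (1 : ℝ≥0∞)) * G (fun i a => (u i).count a) := by
    rw [ofReal_meanAbelianCount]
    refine tsum_congr fun u => ?_
    simp only [G, sum_count_eq_length, Finset.prod_const_one, one_mul]
    refine if_congr (and_congr (forall_congr' fun i => not_congr ?_) (forall_congr' fun i =>
      forall_congr' fun j => imp_congr_right fun _ => ?_)) rfl rfl
    · rw [← List.length_eq_zero_iff, ← sum_count_eq_length, Finset.sum_eq_zero_iff, funext_iff]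
      simp
    · rw [List.perm_iff_count, funext_iff]
  rw [h1, ENNReal.tsum_pi_prod_mul_comp (fun _ _ => 1) (fun (l : List A) a => l.count a) G]
  simp_rw [tsum_ite_count_eq]
  let e : (p.toFinset → A → ℕ) → Fin p.length → A → ℕ :=
    fun x i => x ⟨p.get i, List.mem_toFinset.mpr (p.get_mem i)⟩
  have hsurj : ∀ v : p.toFinset, ∃ i : Fin p.length,
      (⟨p.get i, List.mem_toFinset.mpr (p.get_mem i)⟩ : p.toFinset) = v := fun v => by
    obtain ⟨i, hi⟩ := List.mem_iff_get.mp (List.mem_toFinset.mp v.2)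
    exact ⟨i, Subtype.ext hi⟩
  have he : Function.Injective e := fun x y hxy => by
    funext v
    obtain ⟨i, rfl⟩ := hsurj v
    exact congrFun hxy i
  rw [← he.tsum_eq]
  · refine tsum_congr fun x => ?_
    have hprod := p.prod_get_eq_prod_pow_count fun v =>
      (Nat.multinomial Finset.univ (x v) : ℝ≥0∞)
    have hsum := p.sum_get_eq_sum_count_mul fun v => ∑ a, x v a
    simp only [e, G]
    rw [hprod, hsum]
    congr 1
    refine if_congr ⟨fun h v => ?_, fun h => ⟨fun i => h _, fun i j hij => ?_⟩⟩ rfl rfl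
    · obtain ⟨i, rfl⟩ := hsurj v
      exact h.1 i
    · exact congrArg x (Subtype.ext hij)
  -- A nonzero term has equal count vectors at positions carrying the same variable, so it comes
  -- from a function on the variables.
  · intro y hy
    have hG : G y ≠ 0 := right_ne_zero_of_mul hy
    have hc : ∀ i j, p.get i = p.get j → y i = y j := by
      by_contra hc
      exact hG (if_neg fun h => hc h.2)
    choose j hj using hsurj
    refine ⟨fun v => y (j v), ?_⟩
    funext i
    exact hc _ _ (congrArg Subtype.val (hj _))

/-- The mean as a sum over the lengths of the words substituted for the variables. -/
theorem ofReal_meanAbelianCount_eq_tsum_length {V A : Type*} [DecidableEq V] [Fintype A]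
    [DecidableEq A] [Nonempty A] (p : List V) (n : ℕ) :
    ENNReal.ofReal (meanAbelianCount A p n) = ∑' d : p.toFinset → ℕ,
      (∏ v, ENNReal.ofReal (abelianTerm (Fintype.card A) (p.count v.1) (d v + 1))) *
        ((n + 1 - ∑ v, p.count v.1 * (d v + 1) : ℕ) : ℝ≥0∞) := by
  let f : p.toFinset → (A → ℕ) → ℝ≥0∞ := fun v x =>
    if ∑ a, x a = 0 then 0 else
      ((Nat.multinomial Finset.univ x : ℝ≥0∞) / (Fintype.card A : ℝ≥0∞) ^ (∑ a, x a)) ^ p.count v.1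
  have h1 : ENNReal.ofReal (meanAbelianCount A p n) = ∑' x : p.toFinset → A → ℕ,
      (∏ v, f v (x v)) *
        (fun l : p.toFinset → ℕ => ((n + 1 - ∑ v, p.count v.1 * l v : ℕ) : ℝ≥0∞))
          (fun v => ∑ a, x v a) := by
    rw [ofReal_meanAbelianCount_eq_tsum_count]
    refine tsum_congr fun x => ?_
    have hz : ∀ v, x v = 0 ↔ ∑ a, x v a = 0 := fun v => by
      rw [Finset.sum_eq_zero_iff, funext_iff]
      simp
    by_cases hx : ∀ v, x v ≠ 0
    · rw [if_pos hx]
      have hf : ∀ v, f v (x v) = (Nat.multinomial Finset.univ (x v) : ℝ≥0∞) ^ p.count v.1 *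
          ((Fintype.card A : ℝ≥0∞)⁻¹ ^ (p.count v.1 * ∑ a, x v a)) := fun v => by
        simp only [f]
        rw [if_neg (fun h => hx v ((hz v).mpr h)), div_eq_mul_inv, mul_pow, ENNReal.inv_pow,
          ← pow_mul, mul_comm (p.count v.1)]
      simp_rw [hf]
      rw [Finset.prod_mul_distrib, Finset.prod_pow_eq_pow_sum, div_eq_mul_inv, ENNReal.inv_pow]
      ring
    · rw [if_neg hx]
      push Not at hx
      obtain ⟨v, hv⟩ := hx
      have hf : f v (x v) = 0 := if_pos ((hz v).mp hv)
      rw [mul_zero, Finset.prod_eq_zero (Finset.mem_univ v) hf, zero_mul]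
  have h2 : ∀ (v : p.toFinset) (l : ℕ), (∑' x : A → ℕ, if ∑ a, x a = l then f v x else 0) =
      if l = 0 then 0 else
        ENNReal.ofReal (abelianTerm (Fintype.card A) (p.count v.1) l) := fun v l => by
    by_cases hl : l = 0
    · rw [if_pos hl, ENNReal.tsum_eq_zero]
      intro x
      by_cases hx : ∑ a, x a = l
      · rw [if_pos hx]
        exact if_pos (hx.trans hl)
      · exact if_neg hx
    · rw [if_neg hl, ← tsum_multinomial_eq_abelianTerm]
      refine tsum_congr fun x => if_ctx_congr Iff.rfl (fun hx => ?_) fun _ => rfl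
      exact if_neg (hx ▸ hl)
  rw [h1, ENNReal.tsum_pi_prod_mul_comp f (fun x => ∑ a, x a)
    (fun l => ((n + 1 - ∑ v, p.count v.1 * l v : ℕ) : ℝ≥0∞))]
  simp_rw [h2]
  let e : (p.toFinset → ℕ) → p.toFinset → ℕ := fun d v => d v + 1
  have he : Function.Injective e := fun x y hxy => by
    funext v
    exact Nat.succ_injective (congrFun hxy v)
  rw [← he.tsum_eq]
  · simp [e]
  -- Length 0 contributes nothing, so every nonzero term is a shift by one.
  · intro l hl
    have hl' := left_ne_zero_of_mul hl
    rw [Finset.prod_ne_zero_iff] at hl'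
    refine ⟨fun v => l v - 1, ?_⟩
    funext v
    have : l v ≠ 0 := fun h => hl' v (Finset.mem_univ v) (if_pos h)
    simp only [e]
    omega

/-! ### Summing out the variables that occur once -/

/-- Hockey-stick identity: peel off the first term and apply Pascal's rule. -/
theorem tsum_choose_sub_succ (s : ℕ) : ∀ N : ℕ,
    ∑' j : ℕ, ((N - (j + 1)).choose (s + 1) : ℝ≥0∞) = N.choose (s + 2)
  | 0 => by simp
  | N + 1 => by
    rw [tsum_eq_zero_add' ENNReal.summable, Nat.choose_succ_succ, Nat.cast_add,
      ← tsum_choose_sub_succ s N]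
    simp only [zero_add, Nat.add_sub_cancel]
    congr 1
    refine tsum_congr fun j => ?_
    rw [show N + 1 - (j + 1 + 1) = N - (j + 1) by omega]

theorem tsum_fin_pi_sub_sum_succ : ∀ (s N : ℕ),
    ∑' e : Fin s → ℕ, ((N - ∑ i, (e i + 1) : ℕ) : ℝ≥0∞) = N.choose (s + 1)
  | 0, N => by simp
  | s + 1, N => by
    rw [← (Fin.consEquiv fun _ => ℕ).tsum_eq, ENNReal.tsum_prod', ← tsum_choose_sub_succ]
    refine tsum_congr fun j => ?_
    rw [← tsum_fin_pi_sub_sum_succ]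
    refine tsum_congr fun e => ?_
    rw [Fin.sum_univ_succ, Nat.sub_sub]
    simp [Fin.consEquiv]

theorem tsum_pi_sub_sum_succ {σ : Type*} [Fintype σ] (N : ℕ) :
    ∑' e : σ → ℕ, ((N - ∑ i, (e i + 1) : ℕ) : ℝ≥0∞) = N.choose (Fintype.card σ + 1) := by
  have e := Fintype.equivFin σ
  rw [← tsum_fin_pi_sub_sum_succ, ← (e.symm.arrowCongr (Equiv.refl ℕ)).tsum_eq]
  refine tsum_congr fun x => ?_
  rw [← e.symm.sum_comp]
  simp

/-- Summing out the coordinates of weight one. -/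
theorem tsum_pi_sub_sum_mul_succ {ι : Type*} [Fintype ι] (k : ι → ℕ) (hk : ∀ i, 0 < k i)
    (t : ι → ℕ → ℝ≥0∞) (ht : ∀ i, k i = 1 → ∀ j, t i j = 1) (N : ℕ) :
    ∑' d : ι → ℕ, (∏ i, t i (d i)) * ((N - ∑ i, k i * (d i + 1) : ℕ) : ℝ≥0∞) =
      ∑' d : {i // 1 < k i} → ℕ, (∏ i, t i.1 (d i)) *
        ((N - ∑ i, k i.1 * (d i + 1)).choose (Fintype.card {i // ¬ 1 < k i} + 1) : ℝ≥0∞) := by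
  rw [← (Equiv.piEquivPiSubtypeProd (fun i => 1 < k i) (fun _ => ℕ)).symm.tsum_eq,
    ENNReal.tsum_prod']
  refine tsum_congr fun d => ?_
  rw [← tsum_pi_sub_sum_succ, ← ENNReal.tsum_mul_left]
  refine tsum_congr fun e => ?_
  have hone : ∀ i : {i // ¬ 1 < k i}, k i.1 = 1 := fun i => by
    have h1 := i.2
    have h2 := hk i.1
    omega
  rw [← Fintype.prod_subtype_mul_prod_subtype (fun i => 1 < k i),
    ← Fintype.sum_subtype_add_sum_subtype (fun i => 1 < k i), Nat.sub_sub]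
  have h1 : ∀ i : {i // 1 < k i},
      (Equiv.piEquivPiSubtypeProd (fun i => 1 < k i) (fun _ => ℕ)).symm (d, e) i.1 = d i :=
    fun i => by simp [i.2]
  have h2 : ∀ i : {i // ¬ 1 < k i},
      (Equiv.piEquivPiSubtypeProd (fun i => 1 < k i) (fun _ => ℕ)).symm (d, e) i.1 = e i :=
    fun i => by
      rw [Equiv.piEquivPiSubtypeProd_symm_apply, dif_neg i.2]
  simp only [h1, h2, hone, one_mul, ht _ (hone _), Finset.prod_const_one, mul_one]

/-! ### Passage to the limit -/

theorem tendsto_choose_sub_div_pow (s c : ℕ) :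
    Tendsto (fun n : ℕ => ((n + 1 - c).choose s : ℝ) / (n : ℝ) ^ s) atTop
      (𝓝 (1 / (s.factorial : ℝ))) := by
  have hlim : Tendsto (fun n : ℕ => n + 1 - c) atTop atTop :=
    (tendsto_sub_atTop_nat c).comp (tendsto_add_atTop_nat 1)
  have h1 : Tendsto (fun N : ℕ => (N.choose s : ℝ) / (N : ℝ) ^ s) atTop
      (𝓝 (1 / (s.factorial : ℝ))) := by
    have h := (isEquivalent_choose s).div (Asymptotics.IsEquivalent.refl
      (u := fun N : ℕ => (N : ℝ) ^ s))
    refine h.symm.tendsto_nhds (tendsto_const_nhds.congr' ?_)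
    filter_upwards [eventually_gt_atTop 0] with N hN
    have : (N : ℝ) ≠ 0 := by positivity
    simp only [Pi.div_apply]
    field_simp
  have h2 : Tendsto (fun n : ℕ => (((n + 1 - c : ℕ) : ℝ) / (n : ℝ)) ^ s) atTop (𝓝 1) := by
    rw [← one_pow (M := ℝ) s]
    refine Tendsto.pow ?_ s
    have h3 : Tendsto (fun n : ℕ => 1 + (1 - (c : ℝ)) / (n : ℝ)) atTop (𝓝 (1 + 0)) :=
      tendsto_const_nhds.add (tendsto_const_div_atTop_nhds_zero_nat _)
    rw [add_zero] at h3
    refine h3.congr' ?_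
    filter_upwards [eventually_ge_atTop (c + 1)] with n hn
    have : (n : ℝ) ≠ 0 := by
      have : 0 < n := by omega
      positivity
    rw [Nat.cast_sub (by omega)]
    push_cast
    field_simp
    ring
  have h := (h1.comp hlim).mul h2
  rw [mul_one] at h
  refine h.congr' ?_
  filter_upwards [eventually_ge_atTop (c + 1)] with n hn
  have : ((n + 1 - c : ℕ) : ℝ) ≠ 0 := by
    have : 0 < n + 1 - c := by omega
    positivity
  simp only [Function.comp_apply, div_pow]
  field_simp

theorem choose_sub_div_pow_le (s c n : ℕ) (hn : 0 < n) :
    ((n + 1 - c).choose s : ℝ) / (n : ℝ) ^ s ≤ 2 ^ s := by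
  rw [div_le_iff₀ (by positivity), ← mul_pow]
  -- `n + 1 ≤ 2 n` because `n ≥ 1`; the bound is uniform in `c`, as domination requires.
  have h1 : (n + 1 - c).choose s ≤ (2 * n) ^ s :=
    (Nat.choose_le_pow _ _).trans (Nat.pow_le_pow_left (by omega) s)
  exact_mod_cast h1

theorem hasSum_pi_prod {ι α : Type*} [Fintype ι] (t : ι → α → ℝ) (h0 : ∀ i a, 0 ≤ t i a)
    (ht : ∀ i, Summable (t i)) :
    HasSum (fun x : ι → α => ∏ i, t i (x i)) (∏ i, ∑' a, t i a) := by
  have hE := ENNReal.tsum_pi_prod fun i a => ENNReal.ofReal (t i a)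
  simp_rw [← ENNReal.ofReal_tsum_of_nonneg (h0 _) (ht _),
    ← ENNReal.ofReal_prod_of_nonneg (fun i _ => h0 i _)] at hE
  rw [← ENNReal.ofReal_prod_of_nonneg (fun i _ => tsum_nonneg (h0 i))] at hE
  have hnn : ∀ x : ι → α, 0 ≤ ∏ i, t i (x i) := fun x => Finset.prod_nonneg fun i _ => h0 i _
  have hs : Summable (fun x : ι → α => ∏ i, t i (x i)) := by
    have := ENNReal.summable_toReal (hE ▸ ENNReal.ofReal_ne_top)
    simpa only [ENNReal.toReal_ofReal (hnn _)] using this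
  rw [← ENNReal.ofReal_tsum_of_nonneg hnn hs, ENNReal.ofReal_eq_ofReal_iff (tsum_nonneg hnn)
    (Finset.prod_nonneg fun i _ => tsum_nonneg (h0 i))] at hE
  exact hE ▸ hs.hasSum

theorem tendsto_div_pow_of_ofReal_eq_tsum {ι : Type*} [Fintype ι] (k : ι → ℕ)
    (hk : ∀ i, 0 < k i) (t : ι → ℕ → ℝ) (h0 : ∀ i j, 0 ≤ t i j)
    (hone : ∀ i, k i = 1 → ∀ j, t i j = 1) (hsum : ∀ i, 1 < k i → Summable (t i))
    (a : ℕ → ℝ) (ha0 : ∀ n, 0 ≤ a n)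
    (ha : ∀ n, ENNReal.ofReal (a n) = ∑' d : ι → ℕ, (∏ i, ENNReal.ofReal (t i (d i))) *
      ((n + 1 - ∑ i, k i * (d i + 1) : ℕ) : ℝ≥0∞))
    (s : ℕ) (hs : s = Fintype.card {i // ¬ 1 < k i}) :
    Tendsto (fun n : ℕ => a n / (n : ℝ) ^ (s + 1)) atTop
      (𝓝 (1 / ((s + 1).factorial : ℝ) * ∏ i : {i // 1 < k i}, ∑' j, t i.1 j)) := by
  have hP := hasSum_pi_prod (fun i : {i // 1 < k i} => t i.1) (fun i => h0 i.1)
    (fun i => hsum i.1 i.2)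
  have hnn : ∀ d : {i // 1 < k i} → ℕ, 0 ≤ ∏ i, t i.1 (d i) :=
    fun d => Finset.prod_nonneg fun i _ => h0 _ _
  have ha' : ∀ n, a n = ∑' d : {i // 1 < k i} → ℕ, (∏ i, t i.1 (d i)) *
      ((n + 1 - ∑ i, k i.1 * (d i + 1)).choose (s + 1) : ℝ) := fun n => by
    have h := ha n
    rw [tsum_pi_sub_sum_mul_succ k hk (fun i j => ENNReal.ofReal (t i j))
      (fun i hi j => by rw [hone i hi, ENNReal.ofReal_one]), ← hs] at h
    rw [← ENNReal.toReal_ofReal (ha0 n), h, ENNReal.tsum_toReal_eq]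
    · refine tsum_congr fun d => ?_
      rw [← ENNReal.ofReal_prod_of_nonneg (fun i _ => h0 _ _), ENNReal.toReal_mul,
        ENNReal.toReal_ofReal (hnn d), ENNReal.toReal_natCast]
    · intro d
      rw [← ENNReal.ofReal_prod_of_nonneg (fun i _ => h0 _ _)]
      exact ENNReal.mul_ne_top ENNReal.ofReal_ne_top (ENNReal.natCast_ne_top _)
  simp_rw [ha', ← tsum_div_const, mul_div_assoc]
  rw [mul_comm, ← hP.tsum_eq, ← tsum_mul_right]
  refine tendsto_tsum_of_dominated_convergence
    (bound := fun d => (∏ i, t i.1 (d i)) * 2 ^ (s + 1)) (hP.summable.mul_right _)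
    (fun d => (tendsto_choose_sub_div_pow _ _).const_mul _) ?_
  filter_upwards [eventually_gt_atTop 0] with n hn d
  rw [Real.norm_of_nonneg (mul_nonneg (hnn d) (by positivity))]
  exact mul_le_mul_of_nonneg_left (choose_sub_div_pow_le _ _ n hn) (hnn d)

/-! ### Multinomial bounds and convergence of the series -/

theorem abelianTerm_eq_sum_fin (m k l : ℕ) :
    abelianTerm m k l = ∑ x ∈ Finset.piAntidiag (Finset.univ : Finset (Fin m)) l,
      ((Nat.multinomial Finset.univ x : ℝ) / (m : ℝ) ^ l) ^ k := by
  have h := abelianTerm_eq_sum_piAntidiag (A := Fin m) k l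
  rwa [Fintype.card_fin] at h

theorem abelianTerm_one {m : ℕ} (hm : 0 < m) (l : ℕ) : abelianTerm m 1 l = 1 := by
  have h := Finset.sum_pow_eq_sum_piAntidiag (Finset.univ : Finset (Fin m)) (fun _ => (1 : ℝ)) l
  simp only [Finset.sum_const, Finset.card_univ, Fintype.card_fin, nsmul_eq_mul, mul_one,
    one_pow, Finset.prod_const_one] at h
  have : (m : ℝ) ^ l ≠ 0 := by positivity
  rw [abelianTerm, one_mul]
  simp only [pow_one]
  rw [← h]
  field_simp

theorem abelianTerm_pos {m : ℕ} (hm : 0 < m) (k l : ℕ) : 0 < abelianTerm m k l := by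
  rw [abelianTerm_eq_sum_fin]
  refine Finset.sum_pos (fun x _ => ?_) ?_
  · have := Nat.multinomial_pos (Finset.univ : Finset (Fin m)) x
    positivity
  · have : NeZero m := ⟨hm.ne'⟩
    exact ⟨Pi.single 0 l, by simp [Finset.mem_piAntidiag]⟩

/-- The normalised multinomials are probabilities `P` with sum 1, and `P ^ k ≤ P ^ 2 ≤ b * P`. -/
theorem abelianTerm_le_of_multinomial_le {m k l : ℕ} (hm : 0 < m) (hk : 1 < k) {b : ℝ}
    (hb : ∀ x ∈ Finset.piAntidiag (Finset.univ : Finset (Fin m)) l,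
      (Nat.multinomial Finset.univ x : ℝ) / (m : ℝ) ^ l ≤ b) :
    abelianTerm m k l ≤ b := by
  have h1 := abelianTerm_one hm l
  rw [abelianTerm_eq_sum_fin] at h1 ⊢
  simp only [pow_one] at h1
  have hnn : ∀ x ∈ Finset.piAntidiag (Finset.univ : Finset (Fin m)) l,
      0 ≤ (Nat.multinomial Finset.univ x : ℝ) / (m : ℝ) ^ l := fun x _ => by positivity
  rw [← one_mul b, ← h1, Finset.sum_mul]
  refine Finset.sum_le_sum fun x hx => ?_
  have hle : (Nat.multinomial Finset.univ x : ℝ) / (m : ℝ) ^ l ≤ 1 :=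
    h1 ▸ Finset.single_le_sum hnn hx
  calc _ ≤ ((Nat.multinomial Finset.univ x : ℝ) / (m : ℝ) ^ l) ^ 2 :=
        pow_le_pow_of_le_one (hnn x hx) hle hk
    _ ≤ _ := by
        rw [sq]
        exact mul_le_mul_of_nonneg_left (hb x hx) (hnn x hx)

/-- The sequence `i! / (q + 1) ^ i` has successive ratios `(i + 1) / (q + 1)`, so it is minimal at
`i = q`. -/
theorem factorial_mul_succ_pow_le (q i : ℕ) :
    q.factorial * (q + 1) ^ i ≤ i.factorial * (q + 1) ^ q := by
  rcases le_total q i with h | h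
  · obtain ⟨j, rfl⟩ := Nat.exists_eq_add_of_le h
    rw [pow_add, mul_comm ((q + 1) ^ q), ← mul_assoc]
    exact Nat.mul_le_mul_right _ Nat.factorial_mul_pow_le_factorial
  · obtain ⟨j, rfl⟩ := Nat.exists_eq_add_of_le h
    rw [← Nat.factorial_mul_ascFactorial, pow_add, mul_assoc, mul_comm (_ ^ i)]
    refine Nat.mul_le_mul_left _ (Nat.mul_le_mul_right _ ?_)
    exact (Nat.ascFactorial_le_pow_add i j).trans (Nat.pow_le_pow_left (by omega) j)

/-- A multinomial coefficient is at most about the central one. -/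
theorem multinomial_mul_factorial_pow_le {m q r : ℕ} (x : Fin m → ℕ) (hr : r ≤ m)
    (hx : ∑ i, x i = m * q + r) :
    Nat.multinomial Finset.univ x * q.factorial ^ m ≤ (m * q).factorial * m ^ r := by
  have h1 : q.factorial ^ m * (q + 1) ^ (m * q + r) ≤
      (∏ i, (x i).factorial) * (q + 1) ^ (m * q) := by
    have h := Finset.prod_le_prod' (s := Finset.univ)
      (fun i _ => factorial_mul_succ_pow_le q (x i))
    simpa only [Finset.prod_mul_distrib, Finset.prod_const, Finset.card_univ, Fintype.card_fin,
      Finset.prod_pow_eq_pow_sum, hx, ← pow_mul, mul_comm q m] using h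
  have h2 : q.factorial ^ m * (q + 1) ^ r ≤ ∏ i, (x i).factorial := by
    refine Nat.le_of_mul_le_mul_right (c := (q + 1) ^ (m * q)) ?_ (by positivity)
    rw [mul_assoc, ← pow_add, add_comm r]
    exact h1
  have h3 : (m * q + r).factorial ≤ (m * q).factorial * (m * (q + 1)) ^ r := by
    rw [← Nat.factorial_mul_ascFactorial]
    refine Nat.mul_le_mul_left _ ((Nat.ascFactorial_le_pow_add _ _).trans
      (Nat.pow_le_pow_left ?_ r))
    rw [mul_add, mul_one]
    omega
  refine Nat.le_of_mul_le_mul_right (c := (q + 1) ^ r) ?_ (by positivity)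
  calc _ = Nat.multinomial Finset.univ x * (q.factorial ^ m * (q + 1) ^ r) := by ring
    _ ≤ Nat.multinomial Finset.univ x * ∏ i, (x i).factorial := Nat.mul_le_mul_left _ h2
    _ = (m * q + r).factorial := by rw [mul_comm, Nat.multinomial_spec, hx]
    _ ≤ _ := h3
    _ = _ := by rw [mul_pow]; ring

/-- The Stirling sequence decreases from its value `e / √2` at 1. -/
theorem factorial_le_stirling {n : ℕ} (hn : 0 < n) :
    (n.factorial : ℝ) ≤ Real.exp 1 * √n * (n / Real.exp 1) ^ n := by
  obtain ⟨j, rfl⟩ := Nat.exists_eq_succ_of_ne_zero hn.ne'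
  have h := Stirling.stirlingSeq'_antitone (Nat.zero_le j)
  simp only [Function.comp_apply, Nat.succ_eq_add_one, zero_add, Stirling.stirlingSeq_one] at h
  rw [Stirling.stirlingSeq, div_le_iff₀ (by positivity), Real.sqrt_mul (by norm_num)] at h
  refine h.trans (le_of_eq ?_)
  have : √2 ≠ 0 := by positivity
  field_simp

/-- By Stirling the exponential factors cancel, leaving `√(m q)` over at least `√q ^ m`. Since `m ≥
4`, the denominator is at least `√q ^ 4`, which saves `√q ^ 3`. -/
theorem factorial_mul_div_le {m q : ℕ} (hm : 4 ≤ m) (hq : 0 < q) :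
    ((m * q).factorial : ℝ) / ((q.factorial : ℝ) ^ m * (m : ℝ) ^ (m * q)) ≤
      Real.exp 1 * √m / √q ^ 3 := by
  have hm0 : 0 < m := by omega
  have hq1 : (1 : ℝ) ≤ q := by exact_mod_cast hq
  have hs1 : 1 ≤ √(q : ℝ) := Real.one_le_sqrt.mpr hq1
  have h1 := factorial_le_stirling (Nat.mul_pos hm0 hq)
  have h2 : √(q : ℝ) * (q / Real.exp 1) ^ q ≤ q.factorial := by
    refine le_trans ?_ (Stirling.le_factorial_stirling q)
    refine mul_le_mul_of_nonneg_right (Real.sqrt_le_sqrt ?_) (by positivity)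
    have := Real.pi_gt_three
    nlinarith
  have h3 : √(q : ℝ) ^ m * (q / Real.exp 1) ^ (m * q) ≤ (q.factorial : ℝ) ^ m := by
    have := pow_le_pow_left₀ (by positivity) h2 m
    rwa [mul_pow, ← pow_mul, mul_comm q m] at this
  have h4 : √(q : ℝ) ^ 4 ≤ √(q : ℝ) ^ m := pow_le_pow_right₀ hs1 hm
  rw [div_le_div_iff₀ (by positivity) (by positivity)]
  push_cast at h1
  rw [Real.sqrt_mul (by positivity), mul_div_assoc, mul_pow] at h1
  calc _ ≤ Real.exp 1 * (√m * √q) * ((m : ℝ) ^ (m * q) * (q / Real.exp 1) ^ (m * q)) * √q ^ 3 :=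
        mul_le_mul_of_nonneg_right h1 (by positivity)
    _ = Real.exp 1 * √m * ((√q ^ 4 * (q / Real.exp 1) ^ (m * q)) * (m : ℝ) ^ (m * q)) := by ring
    _ ≤ Real.exp 1 * √m * ((√q ^ m * (q / Real.exp 1) ^ (m * q)) * (m : ℝ) ^ (m * q)) := by
        gcongr
    _ ≤ _ := by gcongr

theorem abelianTerm_le {m k l : ℕ} (hm : 4 ≤ m) (hk : 1 < k) (hl : m ≤ l) :
    abelianTerm m k l ≤ Real.exp 1 * √m * √(2 * m) ^ 3 * (1 / (l : ℝ) ^ (3 / 2 : ℝ)) := by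
  have hm0 : 0 < m := by omega
  have hl0 : 0 < l := by omega
  have hq : 0 < l / m := Nat.div_pos hl hm0
  have hlq : l = m * (l / m) + l % m := (Nat.div_add_mod l m).symm
  have hr : l % m < m := Nat.mod_lt l hm0
  refine (abelianTerm_le_of_multinomial_le hm0 hk (b := Real.exp 1 * √m / √(l / m : ℕ) ^ 3)
    fun x hx => ?_).trans ?_
  · rw [Finset.mem_piAntidiag] at hx
    refine le_trans ?_ (factorial_mul_div_le hm hq)
    have h := multinomial_mul_factorial_pow_le x hr.le (hx.1.trans hlq)
    generalize l / m = q at *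
    generalize l % m = r at *
    rw [div_le_div_iff₀ (by positivity) (by positivity), hlq, pow_add]
    have h' : (Nat.multinomial Finset.univ x : ℝ) * (q.factorial : ℝ) ^ m ≤
        ((m * q).factorial : ℝ) * (m : ℝ) ^ r := by exact_mod_cast h
    have := mul_le_mul_of_nonneg_right h' (show (0 : ℝ) ≤ (m : ℝ) ^ (m * q) by positivity)
    linarith
  -- With `q = l / m ≥ 1`, `l < m (q + 1) ≤ 2 m q`; this trades `q` for `l` in the bound.
  · have hlt : l ≤ 2 * m * (l / m) := by nlinarith
    have hlt' : (l : ℝ) ≤ 2 * m * (l / m : ℕ) := by exact_mod_cast hlt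
    have hpow : (l : ℝ) ^ (3 / 2 : ℝ) = √l ^ 3 := by
      rw [Real.sqrt_eq_rpow, ← Real.rpow_natCast, ← Real.rpow_mul (by positivity)]
      norm_num
    have hs : √(l : ℝ) ^ 3 ≤ √(2 * m) ^ 3 * √(l / m : ℕ) ^ 3 := by
      rw [← mul_pow, ← Real.sqrt_mul (by positivity)]
      exact pow_le_pow_left₀ (by positivity) (Real.sqrt_le_sqrt hlt') 3
    have hq' : (0 : ℝ) < (l / m : ℕ) := by exact_mod_cast hq
    rw [hpow, mul_one_div, div_le_div_iff₀ (pow_pos (Real.sqrt_pos.mpr hq') 3) (by positivity),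
      mul_assoc (Real.exp 1 * √m)]
    exact mul_le_mul_of_nonneg_left hs (by positivity)

theorem summable_abelianTerm {m k : ℕ} (hm : 4 ≤ m) (hk : 1 < k) :
    Summable (fun l : ℕ => abelianTerm m k (l + 1)) := by
  rw [summable_nat_add_iff (f := fun l => abelianTerm m k l) 1]
  refine Summable.of_norm_bounded_eventually_nat
    ((Real.summable_one_div_nat_rpow.mpr (by norm_num : (1 : ℝ) < 3 / 2)).mul_left
      (Real.exp 1 * √m * √(2 * m) ^ 3)) ?_
  filter_upwards [eventually_ge_atTop m] with l hl
  rw [Real.norm_of_nonneg (abelianTerm_nonneg m k l)]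
  exact abelianTerm_le hm hk hl

/-- Here `p.toFinset` is the set of variables that occur in `p`, the variable `v` occurs
`p.count v` times, and `s` is the number of variables that occur exactly once. The convergence
of the series in the product is part of the claim; `ℓ + 1` runs over the integers `≥ 1`. -/
theorem mainTheorem4 {V A : Type*} [DecidableEq V] [Fintype A] [DecidableEq A]
    (m : ℕ) (hm : 4 ≤ m) (hA : Fintype.card A = m) (p : List V)
    (s : ℕ) (hs : s = (p.toFinset.filter (fun v => p.count v = 1)).card) :
    (∀ v ∈ p.toFinset, 1 < p.count v →
      Summable (fun ℓ : ℕ => abelianTerm m (p.count v) (ℓ + 1))) ∧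
    Asymptotics.IsEquivalent Filter.atTop
      (fun n : ℕ => meanAbelianCount A p n)
      (fun n : ℕ => (n : ℝ) ^ (s + 1) / (Nat.factorial (s + 1) : ℝ) *
        ∏ v ∈ p.toFinset.filter (fun v => 1 < p.count v),
          ∑' ℓ : ℕ, abelianTerm m (p.count v) (ℓ + 1)) := by
  refine ⟨fun v _ hv => summable_abelianTerm hm hv, ?_⟩
  subst hA
  have hm0 : 0 < Fintype.card A := by omega
  have : Nonempty A := Fintype.card_pos_iff.mp hm0
  have hcount : ∀ v : p.toFinset, 0 < p.count v.1 := fun v =>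
    List.count_pos_iff.mpr (List.mem_toFinset.mp v.2)
  have hcard : s = Fintype.card {v : p.toFinset // ¬ 1 < p.count v.1} := by
    rw [hs, Fintype.card_subtype, ← Finset.card_map (Function.Embedding.subtype _)]
    congr 1
    ext v
    simp only [Finset.mem_filter, List.mem_toFinset, Finset.mem_map, Finset.mem_univ, true_and,
      Function.Embedding.subtype_apply, Subtype.exists, exists_and_left, exists_prop,
      exists_eq_right_right]
    have := @List.count_pos_iff _ _ _ v p
    constructor
    · rintro ⟨h1, h2⟩
      exact ⟨by omega, h1⟩
    · rintro ⟨h1, h2⟩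
      exact ⟨h2, by have := this.mpr h2; omega⟩
  have hlim := tendsto_div_pow_of_ofReal_eq_tsum (fun v : p.toFinset => p.count v.1) hcount
    (fun v l => abelianTerm (Fintype.card A) (p.count v.1) (l + 1))
    (fun v l => abelianTerm_nonneg _ _ _)
    (fun v hv l => by rw [hv, abelianTerm_one hm0])
    (fun v hv => summable_abelianTerm hm hv)
    (fun n => meanAbelianCount A p n) (fun n => by unfold meanAbelianCount; positivity)
    (fun n => ofReal_meanAbelianCount_eq_tsum_length p n) s hcard
  have hprod : ∏ v : {v : p.toFinset // 1 < p.count v.1},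
      ∑' l : ℕ, abelianTerm (Fintype.card A) (p.count v.1.1) (l + 1) =
      ∏ v ∈ p.toFinset.filter (fun v => 1 < p.count v),
        ∑' l : ℕ, abelianTerm (Fintype.card A) (p.count v) (l + 1) := by
    rw [Finset.prod_filter, ← Finset.prod_coe_sort p.toFinset, ← Finset.prod_filter]
    symm
    refine Finset.prod_subtype _ (fun v => ?_)
      (fun v : p.toFinset => ∑' l : ℕ, abelianTerm (Fintype.card A) (p.count v.1) (l + 1))
    simp
  rw [hprod] at hlim
  set P := ∏ v ∈ p.toFinset.filter (fun v => 1 < p.count v),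
    ∑' l : ℕ, abelianTerm (Fintype.card A) (p.count v) (l + 1) with hP
  -- Asymptotic equivalence needs a nonzero limit to divide by.
  have hPpos : 0 < P := Finset.prod_pos fun v hv =>
    (summable_abelianTerm hm (Finset.mem_filter.mp hv).2).tsum_pos
      (fun l => abelianTerm_nonneg _ _ _) 0 (abelianTerm_pos hm0 _ _)
  refine Asymptotics.isEquivalent_of_tendsto_one ?_
  have h := hlim.div_const (1 / ((s + 1).factorial : ℝ) * P)
  rw [div_self (by positivity)] at h
  refine h.congr fun n => ?_
  simp only [Pi.div_apply]
  rw [div_div]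
  congr 1
  ring
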